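/- Conventions. Subcategories are full and closed under isomorphisms, and objects are counted up to isomorphism. A torsion pair in an abelian category $\mathcal{A}$ is a pair $(\mathcal{T},\mathcal{F})$ of such subcategories with $\mathrm{Hom}(T,F)=0$ for all $T\in\mathcal{T}$, $F\in\mathcal{F}$, such that every object $E$ fits into a short exact sequence $0\to T\to E\to F\to 0$ with $T\in\mathcal{T}$, $F\in\mathcal{F}$; then $\mathcal{T}$ is called a torsion class. An object is endo-trivial if its endomorphism ring is a skew field. The heart $\mathcal{A}$ of a bounded t-structure on a triangulated category $\mathcal{D}$ is algebraic if all its objects are Noetherian and Artinian and it has only finitely many simple objects. Its simple (left) tilt at a simple object $S$ is the heart of a bounded t-structure $$\mathcal{A}_S=\{E\in\mathcal{D} : H^i(E)=0 \text{ for } i\neq 0,1,\ H^0(E)\in\mathcal{F},\ H^1(E)\in\langle S\rangle\},$$ where $H^i$ denotes cohomology with respect to the t-structure with heart $\mathcal{A}$, $\langle S\rangle$ is the smallest subcategory of $\mathcal{A}$ that contains $0$ and $S$ and is closed under extensions, and $\mathcal{F}=\{E\in\mathcal{A} : \mathrm{Hom}(S,E)=0\}$. An algebraic heart $\mathcal{A}$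 with $n$ simple objects can be tilted indefinitely if every heart obtained from $\mathcal{A}$ by a finite sequence of simple tilts is again algebraic with $n$ simple objects. Statement. (1) Let $\mathcal{A}$ be an algebraic heart of a bounded t-structure of a triangulated category $\mathcal{D}$ that can be tilted indefinitely. If there are only finitely many endo-trivial objects in $\mathcal{A}$, then there are only finitely many torsion classes in $\mathcal{A}$. (2) Let $A$ be a finite-dimensional algebra over a field $k$. If there are only finitely many bricks, i.e. finite-dimensional $A$-modules $E$ whose endomorphism ring is a skew field, then the category of finite-dimensional $A$-modules has only finitely many torsion classes. (3) In particular, if $A$ is a finite-dimensional algebra over an algebraically closed field $k$ with only finitely many finite-dimensional modules $E$ such that $\mathrm{Hom}_A(E,E)=k$, then the category of finite-dimensional $A$-modules has only finitely many torsion classes. -/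

import Mathlib

open CategoryTheory CategoryTheory.Limits CategoryTheory.Triangulated

universe u₁ v₁ u₂ u₃ v₂

namespace HeartTilt

universe v u

section Additive

variable {A : Type u} [Category.{v} A] [Preadditive A]

/-- The Gabriel product `P ⋆ Q`: the objects `E` that fit into a short exact sequence
`0 ⟶ X ⟶ E ⟶ Y ⟶ 0` with `X` in `P` and `Y` in `Q`. -/
def gabrielProduct (P Q : ObjectProperty A) : ObjectProperty A := fun E =>
  ∃ (X Y : A) (i : X ⟶ E) (p : E ⟶ Y) (w : i ≫ p = 0),
    (ShortComplex.mk i p w).ShortExact ∧ P X ∧ Q Y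

/-- A torsion pair `(T, F)`; subcategories are full and closed under isomorphisms. -/
structure IsTorsionPair (T F : ObjectProperty A) : Prop where
  isoClosed_torsion : T.IsClosedUnderIsomorphisms
  isoClosed_torsionFree : F.IsClosedUnderIsomorphisms
  hom_eq_zero : ∀ (X Y : A), T X → F Y → ∀ f : X ⟶ Y, f = 0
  mem_gabrielProduct : ∀ E : A, gabrielProduct T F E

/-- A torsion class: the first member of a torsion pair. -/
def IsTorsionClass (T : ObjectProperty A) : Prop :=
  ∃ F : ObjectProperty A, IsTorsionPair T F

/-- `⟨P⟩`: the extension-closed full subcategory generated by `P`. -/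
inductive ExtensionClosure (P : ObjectProperty A) : A → Prop
  | of (X : A) : P X → ExtensionClosure P X
  | zero (X : A) : IsZero X → ExtensionClosure P X
  | iso (X Y : A) : (X ≅ Y) → ExtensionClosure P X → ExtensionClosure P Y
  | ext (S : ShortComplex A) : S.ShortExact →
      ExtensionClosure P S.X₁ → ExtensionClosure P S.X₃ → ExtensionClosure P S.X₂

/-- The torsion class `⟨S⟩` used in the simple tilt at `S`. -/
def simpleTorsion (S : A) : ObjectProperty A :=
  ExtensionClosure (fun X => X = S)

/-- The torsion-free class `{E | Hom(S, E) = 0}` used in the simple tilt at `S`. -/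
def simpleTorsionFree (S : A) : ObjectProperty A := fun E => ∀ f : S ⟶ E, f = 0

/-- An object whose endomorphism ring is a skew field. -/
def IsEndoTrivial (E : A) : Prop :=
  Nontrivial (End E) ∧ ∀ f : End E, f ≠ 0 → IsUnit f

end Additive

/-- The set of isomorphism classes of the objects that satisfy `P`. -/
def isoClasses {A : Type u} [Category.{v} A] (P : ObjectProperty A) :
    Set (Quotient (isIsomorphicSetoid A)) :=
  {c | ∃ E : A, P E ∧ c = Quotient.mk (isIsomorphicSetoid A) E}

section Triangulated

variable {D : Type u} [Category.{v} D] [Preadditive D] [HasZeroObject D] [HasShift D ℤ]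
  [∀ n : ℤ, (shiftFunctor D n).Additive] [Pretriangulated D] [IsTriangulated D]

/-- The heart of a t-structure, as a category. -/
abbrev HeartCat (t : TStructure D) := t.heart.FullSubcategory

/-- The t-structure is bounded: every object is bounded below and above. -/
def IsBounded (t : TStructure D) : Prop := ∀ X : D, t.bounded X

/-- The `n`-th cohomology object `Hⁿ(X)` with respect to a t-structure: the truncation of `X`
to degree `n`, shifted into the heart. -/
noncomputable def cohomology (t : TStructure D) (n : ℤ) (X : D) : D :=
  (shiftFunctor D n).obj ((t.truncGELE n n).obj X)

lemma cohomology_mem_heart (t : TStructure D) (n : ℤ) (X : D) :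
    t.heart (cohomology t n X) := by
  rw [TStructure.mem_heart_iff]
  exact ⟨t.isLE_shift _ n n 0, t.isGE_shift _ n n 0⟩

/-- `Hⁿ(X)` as an object of the heart. -/
noncomputable def heartCohomology (t : TStructure D) (n : ℤ) (X : D) : HeartCat t :=
  ⟨cohomology t n X, cohomology_mem_heart t n X⟩

/-- The left tilt of the heart with respect to `(T, F)`: the objects `E` with `Hⁱ(E) = 0` for
`i ≠ 0, 1`, `H⁰(E)` in `F` and `H¹(E)` in `T`. -/
def leftTilt (t : TStructure D) (T F : ObjectProperty (HeartCat t)) : ObjectProperty D := fun E =>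
  (∀ i : ℤ, i ≠ 0 → i ≠ 1 → IsZero (heartCohomology t i E)) ∧
    F (heartCohomology t 0 E) ∧ T (heartCohomology t 1 E)

/-- The heart of `t'` is the simple left tilt of the heart of `t` at some simple object `S`. -/
def IsSimpleTilt (t t' : TStructure D) : Prop :=
  IsBounded t' ∧ ∃ S : HeartCat t, Simple S ∧
    t'.heart = leftTilt t (simpleTorsion S) (simpleTorsionFree S)

/-- The set of isomorphism classes of simple objects of the heart. -/
def simpleClasses (t : TStructure D) : Set (Quotient (isIsomorphicSetoid (HeartCat t))) :=
  isoClasses (fun S : HeartCat t => Simple S)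

/-- The heart of `t` is an algebraic heart of a bounded t-structure: it has finite length, and
finitely many simple objects up to isomorphism. -/
structure IsAlgebraicHeart (t : TStructure D) : Prop where
  bounded : IsBounded t
  noetherian : ∀ X : HeartCat t, IsNoetherianObject X
  artinian : ∀ X : HeartCat t, IsArtinianObject X
  finite_simples : (simpleClasses t).Finite

/-- The heart of `t` can be tilted indefinitely: every heart obtained from it by a finite sequence
of simple tilts is algebraic with the same number of simple objects. -/
def CanTiltIndefinitely (t : TStructure D) : Prop :=
  ∀ t' : TStructure D, Relation.ReflTransGen IsSimpleTilt t t' →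
    IsAlgebraicHeart t' ∧ (simpleClasses t').ncard = (simpleClasses t).ncard

end Triangulated

/-- `Hom(E, E) = k` for a module `E` over a `k`-algebra: every endomorphism of `E` is
multiplication by a unique scalar. -/
def EndIsBaseField (k : Type*) [Field k] {A : Type*} [Ring A] [Algebra k A]
    (E : FGModuleCat.{v} A) : Prop :=
  ∀ f : E →ₗ[A] E, ∃! c : k, ∀ x : E, f x = algebraMap k A c • x

end HeartTilt

/-! In an abelian category of finite length, a torsion class is determined by the bricks it contains
(`IsTorsionPair.torsion_le_of_endoTrivial`): if one class is not contained in another, a minimality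
argument produces a brick in the first that embeds in a torsion-free object of the second. So
finitely many bricks leave only finitely many possible torsion classes (`finite_torsionClasses`).
The rest verifies the setting: `heartAbelian` makes the heart abelian, finitely generated modules
over a finite-dimensional algebra have finite length, and over an algebraically closed field
`IsEndoTrivial.endIsBaseField` identifies the endomorphisms of a brick with scalars. -/

namespace HeartTilt

universe v u

/-! ### Torsion classes and bricks in abelian categories of finite length -/

section Abelian

variable {A : Type u} [Category.{v} A] [Abelian A]

/-- If `h` is an epimorphism with the same kernel as `h ≫ f`, then `f` is a monomorphism. -/
lemma mono_of_epi_of_forall_comp_eq_zero {X Y Z : A} {f : Y ⟶ Z} {h : X ⟶ Y} [Epi h]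
    (hfh : ∀ {W : A} (x : W ⟶ X), x ≫ h ≫ f = 0 → x ≫ h = 0) : Mono f := by
  rw [Preadditive.mono_iff_cancel_zero]
  intro P k hk
  have hx : pullback.fst h k ≫ h = 0 := hfh _ (by
    rw [← Category.assoc, pullback.condition, Category.assoc, hk, comp_zero])
  rw [pullback.condition] at hx
  -- `pullback.snd` is an epimorphism because `h` is.
  exact zero_of_epi_comp _ hx

lemma subobject_eq_bot_iff_arrow_eq_zero {X : A} (S : Subobject X) : S = ⊥ ↔ S.arrow = 0 := by
  rw [← Subobject.mk_eq_bot_iff_zero, Subobject.mk_arrow]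

/-- The kernels of the powers of `f` stabilise; once they do, the epimorphism `p n` has the same
kernel as `p n ≫ f`, so `f` is a monomorphism. -/
lemma isIso_of_epi_of_isNoetherianObject {M : A} [IsNoetherianObject M] (f : M ⟶ M) [Epi f] :
    IsIso f := by
  let p : ℕ → (M ⟶ M) := fun n => (fun g => g ≫ f)^[n] (𝟙 M)
  have hp : ∀ n, p (n + 1) = p n ≫ f := fun n =>
    Function.iterate_succ_apply' _ _ _
  have hepi : ∀ n, Epi (p n) := fun n => by
    induction n with
    | zero => exact inferInstanceAs (Epi (𝟙 M))
    | succ n ih => rw [hp]; exact epi_comp _ _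
  let K : ℕ → Subobject M := fun n => kernelSubobject (p n)
  have hker : Monotone K := monotone_nat_of_le_succ fun n =>
    le_kernelSubobject (p (n + 1)) (kernelSubobject (p n))
      (by rw [hp, ← Category.assoc, kernelSubobject_arrow_comp, zero_comp])
  obtain ⟨n, hn⟩ := monotone_chain_condition_of_isNoetherianObject ⟨_, hker⟩
  have hn' : kernelSubobject (p n) = kernelSubobject (p (n + 1)) := hn (n + 1) (Nat.le_succ n)
  have : Mono f := by
    have := hepi n
    refine mono_of_epi_of_forall_comp_eq_zero (h := p n) fun x hx => ?_
    have hx' : (kernelSubobject (p (n + 1))).Factors x := kernelSubobject_factors _ _ (by rwa [hp])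
    rw [← hn'] at hx'
    rw [← Subobject.factorThru_arrow _ _ hx', Category.assoc, kernelSubobject_arrow_comp, comp_zero]
  exact isIso_of_mono_of_epi f

namespace IsTorsionPair

variable {T F : ObjectProperty A}

lemma torsion_of_forall_eq_zero (h : IsTorsionPair T F) {X : A}
    (hX : ∀ (Y : A), F Y → ∀ f : X ⟶ Y, f = 0) : T X := by
  obtain ⟨U, V, i, p, w, hS, hU, hV⟩ := h.mem_gabrielProduct X
  have := hS.epi_g
  have hp : p = 0 := hX V hV p
  have := hS.mono_f
  have : Epi i := hS.exact.epi_f hp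
  have : IsIso i := isIso_of_mono_of_epi i
  exact h.isoClosed_torsion.of_iso (asIso i) hU

lemma torsion_of_epi (h : IsTorsionPair T F) {X Y : A} (f : X ⟶ Y) [Epi f] (hX : T X) : T Y :=
  h.torsion_of_forall_eq_zero fun Z hZ g =>
    zero_of_epi_comp f (h.hom_eq_zero X Z hX hZ (f ≫ g))

/-- A torsion class whose bricks lie in a second torsion class is contained in it. Otherwise a
minimal nonzero subobject in `T₁` of an object of `F₂` would be a brick in `T₁`. -/
lemma torsion_le_of_endoTrivial {T₁ F₁ T₂ F₂ : ObjectProperty A}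
    (noeth : ∀ X : A, IsNoetherianObject X) (art : ∀ X : A, IsArtinianObject X)
    (h₁ : IsTorsionPair T₁ F₁) (h₂ : IsTorsionPair T₂ F₂)
    (hle : ∀ E : A, IsEndoTrivial E → T₁ E → T₂ E) : T₁ ≤ T₂ := by
  intro X hX
  refine h₂.torsion_of_forall_eq_zero fun Y hY f => ?_
  by_contra hf
  have := art Y
  have hne : {S : Subobject Y | T₁ (S : A) ∧ S ≠ ⊥}.Nonempty := by
    refine ⟨imageSubobject f, h₁.torsion_of_epi (factorThruImageSubobject f) hX, fun hbot => hf ?_⟩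
    rw [← imageSubobject_arrow_comp f, (subobject_eq_bot_iff_arrow_eq_zero _).1 hbot, comp_zero]
  obtain ⟨M, ⟨hM, hM0⟩, hmin⟩ := WellFounded.has_min
    (wellFounded_lt : WellFounded (α := Subobject Y) (· < ·)) _ hne
  have hMb : IsEndoTrivial (M : A) := by
    refine ⟨⟨𝟙 _, 0, fun h => hM0 ?_⟩, fun g hg => ?_⟩
    · rw [subobject_eq_bot_iff_arrow_eq_zero, ← Category.id_comp M.arrow, h, zero_comp]
    · let g' : (M : A) ⟶ M := g
      have hI : T₁ (Subobject.mk (image.ι g' ≫ M.arrow) : A) := by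
        exact h₁.torsion_of_epi
          (factorThruImage g' ≫ (Subobject.underlyingIso (image.ι g' ≫ M.arrow)).inv) hM
      have hle' : Subobject.mk (image.ι g' ≫ M.arrow) ≤ M :=
        Subobject.mk_le_of_comm (image.ι g') rfl
      have hI0 : Subobject.mk (image.ι g' ≫ M.arrow) ≠ ⊥ := fun h => hg (by
        rw [Subobject.mk_eq_bot_iff_zero] at h
        have h' : image.ι g' = 0 := zero_of_comp_mono M.arrow h
        change g' = 0
        rw [← image.fac g', h', comp_zero])
      have heq : Subobject.mk (image.ι g' ≫ M.arrow) = M :=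
        hle'.eq_of_not_lt (hmin _ ⟨hI, hI0⟩)
      -- Since the image is all of `M` as a subobject of `Y`, its inclusion into `M` has a section.
      have : Epi (image.ι g') := by
        have hs : Subobject.mk M.arrow ≤ Subobject.mk (image.ι g' ≫ M.arrow) := by
          rw [heq, Subobject.mk_arrow]
        obtain ⟨s, hs⟩ : ∃ s : (M : A) ⟶ image g', s ≫ image.ι g' ≫ M.arrow = M.arrow :=
          ⟨Subobject.ofMkLEMk _ _ hs, Subobject.ofMkLEMk_comp hs⟩
        have : s ≫ image.ι g' = 𝟙 _ := by
          rw [← cancel_mono M.arrow, Category.assoc, hs, Category.id_comp]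
        exact (SplitEpi.mk s this).epi
      have : Epi g' := by
        rw [← image.fac g']
        exact epi_comp _ _
      have := noeth (M : A)
      have : IsIso g' := isIso_of_epi_of_isNoetherianObject g'
      exact (isUnit_iff_isIso g').2 this
  exact hM0 ((subobject_eq_bot_iff_arrow_eq_zero _).2 (h₂.hom_eq_zero _ _ (hle _ hMb hM) hY M.arrow))

end IsTorsionPair

/-- An abelian category of finite length with finitely many bricks has finitely many torsion
classes: a torsion class is determined by the bricks that it contains. -/
theorem finite_torsionClasses (noeth : ∀ X : A, IsNoetherianObject X)
    (art : ∀ X : A, IsArtinianObject X)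
    (hfin : (isoClasses (fun E : A => IsEndoTrivial E)).Finite) :
    {T : ObjectProperty A | IsTorsionClass T}.Finite := by
  refine Set.Finite.of_finite_image (f := fun T => isoClasses (fun E : A => IsEndoTrivial E ∧ T E))
    (hfin.finite_subsets.subset ?_) ?_
  · rintro _ ⟨T, -, rfl⟩ c ⟨E, hE, rfl⟩
    exact ⟨E, hE.1, rfl⟩
  · have key : ∀ T₁ T₂ : ObjectProperty A, IsTorsionClass T₁ → IsTorsionClass T₂ →
        isoClasses (fun E : A => IsEndoTrivial E ∧ T₁ E) =
          isoClasses (fun E : A => IsEndoTrivial E ∧ T₂ E) → T₁ ≤ T₂ := by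
      rintro T₁ T₂ ⟨F₁, h₁⟩ ⟨F₂, h₂⟩ heq
      refine h₁.torsion_le_of_endoTrivial noeth art h₂ fun E hE hT => ?_
      obtain ⟨E', ⟨-, hE'⟩, hc⟩ := heq.subset ⟨E, ⟨hE, hT⟩, rfl⟩
      obtain ⟨e⟩ : Nonempty (E ≅ E') := Quotient.exact hc
      exact h₂.isoClosed_torsion.of_iso e.symm hE'
    intro T₁ h₁ T₂ h₂ heq
    exact le_antisymm (key _ _ h₁ h₂ heq) (key _ _ h₂ h₁ heq.symm)

end Abelian

/-! ### The heart of a t-structure is abelian -/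

section Heart

open Pretriangulated

variable {D : Type u} [Category.{v} D] [Preadditive D] [HasZeroObject D] [HasShift D ℤ]
  [∀ n : ℤ, (shiftFunctor D n).Additive] [Pretriangulated D]

lemma heart_eq_zero_of_hom_shift_neg (t : TStructure D) ⦃X Y : HeartCat t⦄ ⦃n : ℤ⦄
    (f : t.heart.ι.obj X ⟶ (t.heart.ι.obj Y)⟦n⟧) (hn : n < 0) : f = 0 := by
  have : t.IsLE (t.heart.ι.obj X) 0 := ((t.mem_heart_iff _).1 X.property).1
  have : t.IsGE Y.obj 0 := ((t.mem_heart_iff _).1 Y.property).2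
  have : t.IsGE ((t.heart.ι.obj Y)⟦n⟧) (-n) := t.isGE_shift Y.obj 0 n (-n)
  exact t.zero f 0 (-n)

/-- The cone of `f` lives in degrees `-1` and `0`, and its truncation triangle supplies the kernel
`L⟦-1⟧` and the cokernel `G` of `f`. -/
lemma heart_admissibleMorphism [IsTriangulated D] (t : TStructure D) :
    AbelianSubcategory.admissibleMorphism t.heart.ι = ⊤ := by
  ext X₁ X₂ f
  simp only [MorphismProperty.top_apply, iff_true]
  intro X₃ f₂ f₃ hT
  obtain ⟨_, _⟩ := (t.mem_heart_iff _).1 X₁.property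
  obtain ⟨_, _⟩ := (t.mem_heart_iff _).1 X₂.property
  have hT' := rot_of_distTriang _ hT
  have : t.IsLE X₃ 0 := t.isLE₂ _ hT' 0 (inferInstanceAs (t.IsLE X₂.obj 0)) (by
    have := t.isLE_shift X₁.obj 0 1 (-1)
    exact t.isLE_of_le (X₁.obj⟦(1 : ℤ)⟧) (-1) 0)
  have : t.IsGE X₃ (-1) := t.isGE₂ _ hT' (-1) (t.isGE_of_ge X₂.obj (-1) 0)
    (t.isGE_shift X₁.obj 0 1 (-1))
  obtain ⟨L, G, i, p, d, hd, _, _, _, _⟩ :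
      ∃ (L G : D) (i : L ⟶ X₃) (p : X₃ ⟶ G) (d : G ⟶ L⟦(1 : ℤ)⟧),
      Triangle.mk i p d ∈ distTriang D ∧ t.IsLE L (-1) ∧ t.IsGE L (-1) ∧ t.IsLE G 0 ∧ t.IsGE G 0 :=
    ⟨(t.truncLE (-1)).obj X₃, (t.truncGE 0).obj X₃, _, _, _,
      t.triangleLEGE_distinguished (-1) 0 (by lia) X₃, inferInstance, inferInstance, inferInstance,
      inferInstance⟩
  let K : HeartCat t := ⟨L⟦(-1 : ℤ)⟧,
    (t.mem_heart_iff _).2 ⟨t.isLE_shift L (-1) (-1) 0, t.isGE_shift L (-1) (-1) 0⟩⟩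
  let Q : HeartCat t := ⟨G, (t.mem_heart_iff _).2 ⟨inferInstance, inferInstance⟩⟩
  let e : (t.heart.ι.obj K)⟦(1 : ℤ)⟧ ≅ L := (shiftEquiv D (1 : ℤ)).counitIso.app L
  have hed : (d ≫ e.inv⟦(1 : ℤ)⟧') ≫ e.hom⟦(1 : ℤ)⟧' = d := by
    rw [Category.assoc, ← Functor.map_comp, e.inv_hom_id, CategoryTheory.Functor.map_id,
      Category.comp_id]
  exact ⟨K, Q, e.hom ≫ i, p, d ≫ e.inv⟦(1 : ℤ)⟧', isomorphic_distinguished _ hd _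
    (Triangle.isoMk _ _ e (Iso.refl _) (Iso.refl _) (Category.comp_id _)
      ((Category.comp_id _).trans (Category.id_comp _).symm)
      (hed.trans (Category.id_comp d).symm))⟩

lemma heart_isZero (t : TStructure D) {X : D} (hX : IsZero X) : t.heart X :=
  (t.mem_heart_iff _).2 ⟨t.isLE_of_isZero hX 0, t.isGE_of_isZero hX 0⟩

lemma heart_hasFiniteProducts (t : TStructure D) : HasFiniteProducts (HeartCat t) := by
  have : t.heart.IsClosedUnderBinaryProducts := ⟨by
    rintro X ⟨p⟩
    have h₁ := (t.mem_heart_iff _).1 (p.prop_diag_obj (.mk .left))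
    have h₂ := (t.mem_heart_iff _).1 (p.prop_diag_obj (.mk .right))
    have hd := binaryProductTriangle_distinguished
      (p.diag.obj (.mk .left)) (p.diag.obj (.mk .right))
    refine t.heart.prop_of_iso ?_
      ((t.mem_heart_iff _).2 ⟨t.isLE₂ _ hd 0 h₁.1 h₂.1, t.isGE₂ _ hd 0 h₁.2 h₂.2⟩)
    exact IsLimit.conePointUniqueUpToIso (prodIsProd _ _)
      ((IsLimit.postcomposeHomEquiv (diagramIsoPair p.diag) _).2 p.isLimit)⟩
  have : t.heart.ContainsZero := ⟨_, isZero_zero D, heart_isZero t (isZero_zero D)⟩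
  have : t.heart.IsClosedUnderFiniteProducts := .mk'
  infer_instance

noncomputable instance heartAbelian [IsTriangulated D] (t : TStructure D) : Abelian (HeartCat t) :=
  have := heart_hasFiniteProducts t
  AbelianSubcategory.abelian t.heart.ι (heart_eq_zero_of_hom_shift_neg t)
    (heart_admissibleMorphism t)

end Heart

/-! ### Chain conditions for finitely generated modules -/

section Modules

variable {R : Type u} [Ring R] [IsNoetherianRing R]

/-- This transfers the chain conditions from submodules to categorical subobjects. -/
lemma strictMono_range_subobject_arrow (E : FGModuleCat.{v} R) :
    StrictMono fun S : Subobject E => LinearMap.range S.arrow.hom.hom := by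
  refine Monotone.strictMono_of_injective ?_ ?_
  · intro S T h
    dsimp only
    rw [← Subobject.ofLE_arrow h]
    exact LinearMap.range_comp_le_range _ _
  · have key : ∀ S T : Subobject E,
        LinearMap.range S.arrow.hom.hom = LinearMap.range T.arrow.hom.hom → S ≤ T := by
      intro S T h
      have hT : Function.Injective T.arrow.hom.hom :=
        (ModuleCat.mono_iff_injective ((forget₂ (FGModuleCat.{v} R) (ModuleCat.{v} R)).map
          T.arrow)).1 inferInstance
      let e := LinearEquiv.ofInjective _ hT
      let g : (S : FGModuleCat.{v} R) ⟶ (T : FGModuleCat.{v} R) :=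
        FGModuleCat.ofHom (e.symm.toLinearMap ∘ₗ
          S.arrow.hom.hom.codRestrict _ fun x => h ▸ LinearMap.mem_range_self _ x)
      refine Subobject.le_of_comm g (FGModuleCat.hom_ext (LinearMap.ext fun x => ?_))
      exact congrArg Subtype.val (e.apply_symm_apply ⟨S.arrow.hom.hom x, _⟩)
    exact fun S T h => le_antisymm (key S T h) (key T S h.symm)

lemma isNoetherianObject_fgModuleCat (E : FGModuleCat.{v} R) : IsNoetherianObject E :=
  ⟨(strictMono_range_subobject_arrow E).wellFoundedGT⟩

lemma isArtinianObject_fgModuleCat [IsArtinianRing R] (E : FGModuleCat.{v} R) :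
    IsArtinianObject E :=
  ⟨(strictMono_range_subobject_arrow E).wellFoundedLT⟩

end Modules

/-! ### Finite-dimensional algebras -/

section Algebra

/-- A finite-dimensional algebra with finitely many bricks has finitely many torsion classes. -/
theorem finite_torsionClasses_fgModuleCat (k : Type*) [Field k] {A : Type u} [Ring A]
    [Algebra k A] [FiniteDimensional k A]
    (hfin : (isoClasses (fun E : FGModuleCat.{v} A => IsEndoTrivial E)).Finite) :
    {T : ObjectProperty (FGModuleCat.{v} A) | IsTorsionClass T}.Finite := by
  have : IsNoetherianRing A := isNoetherian_of_tower k inferInstance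
  have : IsArtinianRing A := isArtinian_of_tower k inferInstance
  exact finite_torsionClasses isNoetherianObject_fgModuleCat isArtinianObject_fgModuleCat hfin

/-- Schur's lemma for bricks over an algebraically closed field. -/
lemma IsEndoTrivial.endIsBaseField (k : Type*) [Field k] [IsAlgClosed k] {A : Type u} [Ring A]
    [Algebra k A] [FiniteDimensional k A] {E : FGModuleCat.{v} A}
    (h : IsEndoTrivial E) : EndIsBaseField k E := by
  let _ : Module k E := Module.compHom E (algebraMap k A)
  have hsmul : ∀ (c : k) (x : E), c • x = algebraMap k A c • x := fun _ _ => rfl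
  have : IsScalarTower k A E := ⟨fun c a x => by
    rw [hsmul, Algebra.smul_def, mul_smul]⟩
  have : SMulCommClass A k E := ⟨fun a c x => by
    rw [hsmul, hsmul, ← mul_smul, ← mul_smul, Algebra.commutes]⟩
  have : FiniteDimensional k E := Module.Finite.trans A E
  have hne : Nontrivial E := by
    by_contra hE
    rw [not_nontrivial_iff_subsingleton] at hE
    have := h.1
    exact zero_ne_one (α := End E)
      (FGModuleCat.hom_ext (LinearMap.ext fun x => Subsingleton.elim _ _))
  intro f
  obtain ⟨c, hc⟩ := Module.End.exists_eigenvalue (K := k) (V := E) (f.restrictScalars k)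
  obtain ⟨x, hx, hx0⟩ := hc.exists_hasEigenvector
  have hx : f x = c • x := Module.End.mem_eigenspace_iff.1 hx
  refine ⟨c, ?_, fun d hd => ?_⟩
  · let g : E →ₗ[A] E := f - c • LinearMap.id
    have hg : g x = 0 := by simp [g, hx]
    -- `g = f - c` kills the eigenvector `x`, so it is not invertible and must vanish.
    have : (FGModuleCat.ofHom g : End E) = 0 := by
      by_contra hne
      obtain ⟨u, hu⟩ := h.2 _ hne
      -- Multiplication in `End E` reverses `≫`, hence `u.inv_mul`.
      have h1 : (FGModuleCat.ofHom g : E ⟶ E) ≫ (↑u⁻¹ : End E) = 𝟙 E := by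
        have := u.inv_mul
        rw [hu] at this
        exact this
      apply hx0
      have h2 := congrArg (fun q : E ⟶ E => q.hom.hom x) h1
      refine h2.symm.trans ?_
      change (↑u⁻¹ : End E).hom.hom (g x) = 0
      rw [hg, map_zero]
    intro y
    have h3 : g y = 0 := congrArg (fun q : E ⟶ E => q.hom.hom y) this
    exact sub_eq_zero.1 h3
  · have h4 : d • x = c • x := (hd x).symm.trans hx
    exact smul_left_injective k hx0 h4

end Algebra

end HeartTilt

theorem mainTheorem6 :
    -- algebraic hearts that can be tilted indefinitely
    (∀ (D : Type u₁) [Category.{v₁} D] [Preadditive D] [HasZeroObject D] [HasShift D ℤ]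
      [∀ n : ℤ, (shiftFunctor D n).Additive] [Pretriangulated D] [IsTriangulated D]
      (t : TStructure D),
      HeartTilt.IsAlgebraicHeart t → HeartTilt.CanTiltIndefinitely t →
      (HeartTilt.isoClasses
        (fun E : HeartTilt.HeartCat t => HeartTilt.IsEndoTrivial E)).Finite →
      {T : ObjectProperty (HeartTilt.HeartCat t) | HeartTilt.IsTorsionClass T}.Finite) ∧
    -- finite-dimensional algebras over a field, bricks: the endomorphism ring is a skew field
    (∀ (k : Type u₂) [Field k] (A : Type u₃) [Ring A] [Algebra k A] [FiniteDimensional k A],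
      (HeartTilt.isoClasses
        (fun E : FGModuleCat.{v₂} A => HeartTilt.IsEndoTrivial E)).Finite →
      {T : ObjectProperty (FGModuleCat.{v₂} A) | HeartTilt.IsTorsionClass T}.Finite) ∧
    -- finite-dimensional algebras over an algebraically closed field, bricks: `Hom(E, E) = k`
    (∀ (k : Type u₂) [Field k] [IsAlgClosed k] (A : Type u₃) [Ring A] [Algebra k A]
      [FiniteDimensional k A],
      (HeartTilt.isoClasses
        (fun E : FGModuleCat.{v₂} A => HeartTilt.EndIsBaseField k E)).Finite →
      {T : ObjectProperty (FGModuleCat.{v₂} A) | HeartTilt.IsTorsionClass T}.Finite) := by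
  refine ⟨fun D _ _ _ _ _ _ _ t h _ hfin =>
      HeartTilt.finite_torsionClasses h.noetherian h.artinian hfin,
    fun k _ A _ _ _ hfin => HeartTilt.finite_torsionClasses_fgModuleCat k hfin,
    fun k _ _ A _ _ _ hfin =>
      HeartTilt.finite_torsionClasses_fgModuleCat k (hfin.subset ?_)⟩
  rintro _ ⟨E, hE, rfl⟩
  exact ⟨E, hE.endIsBaseField k, rfl⟩
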